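/- Let $K$ be an algebraically closed field, let $n\ge 1$, and let $A,B$ be commuting nilpotent $n\times n$ matrices over $K$ such that the commutative subalgebra $K[A,B]\subset M_n(K)$ generated by $A$ and $B$ satisfies $\dim_K K[A,B]=n$. Let $M=(A,B)$ be the maximal ideal of the local ring $K[A,B]$, let $H=(h_0,h_1,\dots)$, $h_i=\dim_K M^i/M^{i+1}$, be its Hilbert function, and let $j$ be the socle degree of $H$, i.e. the largest $i$ with $h_i\neq 0$. Assume that $\operatorname{char} K=0$ or $\operatorname{char} K>j$. Then for generic $t$, that is, for all but finitely many $t\in K$, both $A$ and $B$ belong to the Jacobson radical of the centralizer algebra $\mathcal C_t=\{X\in M_n(K) : X(A+tB)=(A+tB)X\}$ of $A+tB$. -/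

import Mathlib

/-- The `i`-th graded piece `m ^ i / m ^ (i + 1)` of the associated graded algebra of a
commutative `K`-algebra `R` with respect to an ideal `m`. -/
abbrev gradedPiece (K : Type*) [Field K] {R : Type*} [CommRing R] [Algebra K R] (m : Ideal R)
    (i : ℕ) : Type _ :=
  ↥((m ^ i).restrictScalars K) ⧸
    ((m ^ (i + 1)).restrictScalars K).submoduleOf ((m ^ i).restrictScalars K)

/-- The Hilbert function `i ↦ dim_K (m ^ i / m ^ (i + 1))` of a commutative `K`-algebra with
respect to an ideal `m`. -/
noncomputable def hilbertFunction (K : Type*) [Field K] {R : Type*} [CommRing R] [Algebra K R]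
    (m : Ideal R) (i : ℕ) : ℕ :=
  Module.finrank K (gradedPiece K m i)

/-- `j` is the socle degree of the Hilbert function: the largest `i` with `h_i ≠ 0`. -/
def IsSocleDegree (K : Type*) [Field K] {R : Type*} [CommRing R] [Algebra K R]
    (m : Ideal R) (j : ℕ) : Prop :=
  IsGreatest {i : ℕ | hilbertFunction K m i ≠ 0} j

/-- The algebra `K[A, B]` generated by two matrices. -/
abbrev pairAlgebra {K : Type*} [Field K] {n : ℕ} (A B : Matrix (Fin n) (Fin n) K) :
    Subalgebra K (Matrix (Fin n) (Fin n) K) :=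
  Algebra.adjoin K {A, B}

theorem pairAlgebra_mul_comm {K : Type*} [Field K] {n : ℕ} {A B : Matrix (Fin n) (Fin n) K}
    (hAB : Commute A B) (x y : pairAlgebra A B) : x * y = y * x := by
  have key : ∀ a ∈ ({A, B} : Set (Matrix (Fin n) (Fin n) K)),
      ∀ b ∈ ({A, B} : Set (Matrix (Fin n) (Fin n) K)), a * b = b * a := by
    rintro a (rfl | rfl) b (rfl | rfl)
    · rfl
    · exact hAB
    · exact hAB.symm
    · rfl
  exact (Algebra.isMulCommutative_adjoin K key).is_comm.comm x y

/-- For commuting `A`, `B` the algebra `K[A, B]` is commutative. -/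
abbrev pairCommRing {K : Type*} [Field K] {n : ℕ} {A B : Matrix (Fin n) (Fin n) K}
    (hAB : Commute A B) : CommRing (pairAlgebra A B) :=
  { (pairAlgebra A B).toRing with mul_comm := pairAlgebra_mul_comm hAB }

/-- `j` is the socle degree of `K[A, B]` with respect to the ideal `M = (A, B)`. For commuting
nilpotent `A`, `B` (and `n ≥ 1`), `M` is the maximal ideal of the local ring `K[A, B]`, the image
of the ideal `(x, y)` of `K[[x, y]]`. -/
def IsPairSocleDegree {K : Type*} [Field K] {n : ℕ} {A B : Matrix (Fin n) (Fin n) K}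
    (hAB : Commute A B) (j : ℕ) : Prop :=
  letI : CommRing (pairAlgebra A B) := pairCommRing hAB
  IsSocleDegree K (R := pairAlgebra A B)
    (Ideal.span {⟨A, Algebra.subset_adjoin (Set.mem_insert A {B})⟩,
      ⟨B, Algebra.subset_adjoin (Set.mem_insert_of_mem A rfl)⟩}) j

/-- The centralizer (commutator) algebra of a matrix `C` in the full matrix algebra. -/
abbrev matrixCentralizer {K : Type*} [Field K] {n : ℕ} (C : Matrix (Fin n) (Fin n) K) :
    Subalgebra K (Matrix (Fin n) (Fin n) K) :=
  Subalgebra.centralizer K {C}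

/-- `X` belongs to the Jacobson radical of the centralizer algebra of `C`. -/
def MemCentralizerRadical {K : Type*} [Field K] {n : ℕ}
    (C X : Matrix (Fin n) (Fin n) K) : Prop :=
  ∃ h : X ∈ matrixCentralizer C,
    (⟨X, h⟩ : matrixCentralizer C) ∈ Ring.jacobson (matrixCentralizer C)

/-! Put `l = A + t • B`, `b = B`, and let `d_a = dim (ker l ∩ im l^a)`, the number of Jordan blocks
of `l` of size greater than `a`. The theorem follows once, for generic `t`, the blocks of `l` have
distinct sizes, that is `d_p ≤ d_{p+1} + 1`. A nilpotent `Z` commuting with `l` then pushes each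
step of the filtration `ker l ∩ im l^p` into the next, and so does `X * Z` for every `X` in the
centralizer. All left multiples of `Z` are therefore nilpotent, so `Z` is in the radical
(`isNilpotent_mul_of_finrank_kerInfRange_le`).

To bound the multiplicities, let `N_a` be the least `k` such that `l^a b^k` is a combination of
products `l^c b^i` with `i < k`. Cayley–Hamilton for `b` on `im l^a`, which has `d_a` generators
over `K[l]`, gives `N_a ≤ d_a`. The products `l^a b^i` with `i < N_a` span `K[l, b] = K[A, B]`, so
`n ≤ ∑ N_a ≤ ∑ d_a = n` and `N_a = d_a` for all `a` (`finrank_kerInfRange_le_succ`).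

Finally, for generic `t` a relation for `l^(p+1) b^k` comes from one over `K[t]`. Since `dl/dt = b`,
its derivative is a relation for `(p+1) l^p b^(k+1)`, whence `N_p ≤ N_{p+1} + 1`
(`eventually_lowSpan_derivative`). The characteristic enters only in dividing by `p+1`. -/

open Polynomial in
/-- An element of a finite module over `K[X]` either has a nonzero multiple in the span of `W`, or is
separated from `W` by a linear functional. -/
theorem exists_smul_mem_span_or_exists_functional {K M : Type*} [Field K] [AddCommGroup M]
    [Module K[X] M] [Module.Finite K[X] M] (v : M) (W : Set M) :
    (∃ f : K[X], f ≠ 0 ∧ f • v ∈ Submodule.span K[X] W) ∨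
      ∃ φ : M →ₗ[K[X]] K[X], (∀ w ∈ W, φ w = 0) ∧ φ v ≠ 0 := by
  let Q := M ⧸ Submodule.span K[X] W
  -- A finitely generated torsion-free module over the principal ideal domain `K[X]` is free, so
  -- functionals separate the points of `T`.
  let T := Q ⧸ Submodule.torsion K[X] Q
  let π : M →ₗ[K[X]] T := (Submodule.mkQ _).comp (Submodule.mkQ _)
  by_cases hv : π v = 0
  · left
    have : Submodule.Quotient.mk v ∈ Submodule.torsion K[X] Q :=
      (Submodule.Quotient.mk_eq_zero _).1 hv
    obtain ⟨f, hf⟩ := this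
    refine ⟨f, nonZeroDivisors.coe_ne_zero f, ?_⟩
    rw [← Submodule.Quotient.mk_eq_zero]
    exact hf
  · right
    have := mt (Module.forall_dual_apply_eq_zero_iff K[X] (π v)).1 hv
    push Not at this
    obtain ⟨ψ, hψ⟩ := this
    refine ⟨ψ.comp π, fun w hw => ?_, hψ⟩
    have : (Submodule.Quotient.mk w : Q) = 0 :=
      (Submodule.Quotient.mk_eq_zero _).2 (Submodule.subset_span hw)
    have h0 : π w = 0 := by
      change Submodule.mkQ _ (Submodule.Quotient.mk w : Q) = 0
      rw [this, map_zero]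
    simp [h0]

/-! ### Polynomial matrices: specialization and differentiation -/

section EvalMatrix

open Polynomial

variable {K : Type*} [Field K] {n : ℕ}

/-- Evaluation of a polynomial matrix. -/
noncomputable def evalMatrix (t : K) :
    Matrix (Fin n) (Fin n) K[X] →+* Matrix (Fin n) (Fin n) K :=
  (evalRingHom t).mapMatrix

/-- Constant polynomial matrices. -/
noncomputable def constMatrix :
    Matrix (Fin n) (Fin n) K →+* Matrix (Fin n) (Fin n) K[X] :=
  (C : K →+* K[X]).mapMatrix

theorem evalMatrix_constMatrix (t : K) (M : Matrix (Fin n) (Fin n) K) :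
    evalMatrix t (constMatrix M) = M := by
  ext i j; simp [evalMatrix, constMatrix]

theorem evalMatrix_smul (t : K) (f : K[X]) (M : Matrix (Fin n) (Fin n) K[X]) :
    evalMatrix t (f • M) = f.eval t • evalMatrix t M := by
  ext i j; simp [evalMatrix]

theorem constMatrix_smul (c : K) (M : Matrix (Fin n) (Fin n) K) :
    constMatrix (c • M) = C c • constMatrix M := by
  ext i j; simp [constMatrix]

/-- A functional on polynomial matrices induces a functional on each specialization. -/
noncomputable def specializeFunctional (φ : Matrix (Fin n) (Fin n) K[X] →ₗ[K[X]] K[X]) (t : K) :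
    Matrix (Fin n) (Fin n) K →ₗ[K] K where
  toFun M := (φ (constMatrix M)).eval t
  map_add' := by simp
  map_smul' := by simp [constMatrix_smul]

/-- `M` differs from the constant matrix of its value at `t` by a multiple of `X - t`, which dies on
evaluation at `t`. -/
theorem specializeFunctional_evalMatrix (φ : Matrix (Fin n) (Fin n) K[X] →ₗ[K[X]] K[X]) (t : K)
    (M : Matrix (Fin n) (Fin n) K[X]) :
    specializeFunctional φ t (evalMatrix t M) = (φ M).eval t := by
  have hd : ∀ i j, ∃ c, M i j - C ((M i j).eval t) = (X - C t) * c := fun i j =>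
    X_sub_C_dvd_sub_C_eval
  choose c hc using hd
  have hM : M = constMatrix (evalMatrix t M) + (X - C t) • Matrix.of c := by
    ext1 i j
    simp [constMatrix, evalMatrix, ← hc]
  conv_rhs => rw [hM, map_add, map_smul]
  simp [specializeFunctional]

/-- If `v` specializes into the span of the specializations of `W` at infinitely many points, then a
nonzero multiple of `v` lies in the span of `W`. -/
theorem exists_smul_mem_span_or_eventually_notMem (v : Matrix (Fin n) (Fin n) K[X])
    (W : Set (Matrix (Fin n) (Fin n) K[X])) :
    (∃ f : K[X], f ≠ 0 ∧ f • v ∈ Submodule.span K[X] W) ∨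
      ∀ᶠ t : K in Filter.cofinite, evalMatrix t v ∉ Submodule.span K (evalMatrix t '' W) := by
  refine (exists_smul_mem_span_or_exists_functional v W).imp_right ?_
  rintro ⟨φ, hW, hv⟩
  refine (Polynomial.finite_setOfPred_isRoot hv).subset fun t ht => ?_
  have ht : evalMatrix t v ∈ Submodule.span K (evalMatrix t '' W) := by simpa using ht
  have : Submodule.span K (evalMatrix t '' W) ≤ LinearMap.ker (specializeFunctional φ t) := by
    rw [Submodule.span_le]
    rintro _ ⟨w, hw, rfl⟩
    simp [specializeFunctional_evalMatrix, hW w hw]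
  have := this ht
  rwa [LinearMap.mem_ker, specializeFunctional_evalMatrix] at this

/-- Entrywise derivative of a polynomial matrix. -/
noncomputable def derivMatrix (M : Matrix (Fin n) (Fin n) K[X]) : Matrix (Fin n) (Fin n) K[X] :=
  M.map derivative

theorem derivMatrix_add (M N : Matrix (Fin n) (Fin n) K[X]) :
    derivMatrix (M + N) = derivMatrix M + derivMatrix N := by
  ext1 i j; simp [derivMatrix]

theorem derivMatrix_zero : derivMatrix (0 : Matrix (Fin n) (Fin n) K[X]) = 0 := by
  ext1 i j; simp [derivMatrix]

theorem derivMatrix_smul (f : K[X]) (M : Matrix (Fin n) (Fin n) K[X]) :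
    derivMatrix (f • M) = derivative f • M + f • derivMatrix M := by
  ext1 i j; simp [derivMatrix]

theorem derivMatrix_mul (M N : Matrix (Fin n) (Fin n) K[X]) :
    derivMatrix (M * N) = derivMatrix M * N + M * derivMatrix N := by
  ext1 i j; simp [derivMatrix, Matrix.mul_apply, Finset.sum_add_distrib]

theorem derivMatrix_constMatrix (M : Matrix (Fin n) (Fin n) K) :
    derivMatrix (constMatrix M) = 0 := by
  ext1 i j; simp [derivMatrix, constMatrix]

theorem derivMatrix_pow {M : Matrix (Fin n) (Fin n) K[X]} (h : Commute M (derivMatrix M)) (a : ℕ) :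
    derivMatrix (M ^ a) = (a : K[X]) • (M ^ (a - 1) * derivMatrix M) := by
  induction a with
  | zero =>
    have : (1 : Matrix (Fin n) (Fin n) K[X]) = constMatrix 1 := (map_one _).symm
    rw [pow_zero, this, derivMatrix_constMatrix, Nat.cast_zero, zero_smul]
  | succ a ih =>
    rw [pow_succ, derivMatrix_mul, ih]
    rcases a with _ | a
    · simp
    · rw [smul_mul_assoc, mul_assoc, h.symm.eq, ← mul_assoc]
      simp only [Nat.add_sub_cancel, ← pow_succ]
      push_cast
      simp only [add_smul, one_smul]

end EvalMatrix

/-! ### Differentiating relations between powers of `A + tB` and `B` -/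

/-- The span of the products `l ^ a * b ^ i` with `i < k`. -/
def lowSpan (K : Type*) {E : Type*} [Field K] [Ring E] [Algebra K E] (l b : E) (k : ℕ) :
    Submodule K E :=
  Submodule.span K {x | ∃ a i, i < k ∧ x = l ^ a * b ^ i}

section LowSpan

variable {K E : Type*} [Field K] [Ring E] [Algebra K E] {l b : E}

theorem pow_mul_pow_mem_lowSpan (a : ℕ) {i k : ℕ} (h : i < k) : l ^ a * b ^ i ∈ lowSpan K l b k :=
  Submodule.subset_span ⟨a, i, h, rfl⟩

theorem lowSpan_mono {k m : ℕ} (h : k ≤ m) : lowSpan K l b k ≤ lowSpan K l b m :=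
  Submodule.span_mono fun _ ⟨a, i, hi, hx⟩ => ⟨a, i, hi.trans_le h, hx⟩

end LowSpan

open Polynomial in
/-- For generic `t`, a relation expressing `(A + tB) ^ (p + 1) * B ^ k` through lower powers of `B`
can be differentiated with respect to `t`. -/
theorem eventually_lowSpan_derivative {K : Type*} [Field K] {n : ℕ}
    {A B : Matrix (Fin n) (Fin n) K} (hAB : Commute A B) (p k : ℕ) (hp : ((p + 1 : ℕ) : K) ≠ 0) :
    ∀ᶠ t : K in Filter.cofinite, (A + t • B) ^ (p + 1) * B ^ k ∈ lowSpan K (A + t • B) B k →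
      (A + t • B) ^ p * B ^ (k + 1) ∈ lowSpan K (A + t • B) B (k + 1) := by
  let l : Matrix (Fin n) (Fin n) K[X] := constMatrix A + (X : K[X]) • constMatrix B
  let b : Matrix (Fin n) (Fin n) K[X] := constMatrix B
  have hl (t : K) : evalMatrix t l = A + t • B := by
    simp [l, evalMatrix_smul, evalMatrix_constMatrix]
  have hb (t : K) : evalMatrix t b = B := evalMatrix_constMatrix t B
  have hdl : derivMatrix l = b := by
    simp [l, b, derivMatrix_add, derivMatrix_smul, derivMatrix_constMatrix]
  have hlb : Commute l b :=
    (hAB.map constMatrix).add_left ((Commute.refl _).smul_left _)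
  have hdb (i : ℕ) : derivMatrix (b ^ i) = 0 := by
    rw [← map_pow, derivMatrix_constMatrix]
  have hd (a i : ℕ) :
      derivMatrix (l ^ a * b ^ i) = (a : K[X]) • (l ^ (a - 1) * b ^ (i + 1)) := by
    rw [derivMatrix_mul, derivMatrix_pow (by rwa [hdl]), hdl, hdb, mul_zero, add_zero,
      smul_mul_assoc, mul_assoc, ← pow_succ']
  let W : Set (Matrix (Fin n) (Fin n) K[X]) := {x | ∃ a i, i < k ∧ x = l ^ a * b ^ i}
  -- Either the relation holds over `K[X]` up to a factor `f`, and every `t` with `f(t) ≠ 0` is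
  -- good, or its specialization fails for almost all `t` and the implication is vacuous.
  rcases exists_smul_mem_span_or_eventually_notMem (l ^ (p + 1) * b ^ k) W with ⟨f, hf, hmem⟩ | h
  · refine (Polynomial.finite_setOfPred_isRoot hf).subset fun t ht => ?_
    by_contra hft
    refine ht fun _ => ?_
    have key : ∀ x ∈ Submodule.span K[X] W,
        evalMatrix t x ∈ lowSpan K (A + t • B) B k ∧
        evalMatrix t (derivMatrix x) ∈ lowSpan K (A + t • B) B (k + 1) := by
      intro x hx
      induction hx using Submodule.span_induction with
      | mem x h =>
        obtain ⟨a, i, hi, rfl⟩ := h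
        constructor
        · rw [map_mul, map_pow, map_pow, hl, hb]
          exact pow_mul_pow_mem_lowSpan a hi
        · rw [hd, evalMatrix_smul, map_mul, map_pow, map_pow, hl, hb]
          exact Submodule.smul_mem _ _ (pow_mul_pow_mem_lowSpan _ (by omega))
      | zero => simp [derivMatrix_zero]
      | add x y _ _ hx hy =>
        rw [derivMatrix_add, map_add, map_add]
        exact ⟨add_mem hx.1 hy.1, add_mem hx.2 hy.2⟩
      | smul g x _ hx =>
        rw [derivMatrix_smul, map_add, evalMatrix_smul, evalMatrix_smul, evalMatrix_smul]
        exact ⟨Submodule.smul_mem _ _ hx.1, add_mem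
          (Submodule.smul_mem _ _ (lowSpan_mono k.le_succ hx.1)) (Submodule.smul_mem _ _ hx.2)⟩
    have h2 := (key _ hmem).2
    -- The term with `f'` is a multiple of `l^(p+1) b^k`, already in the span for `k + 1`; what
    -- remains is `f(t) (p+1) l^p b^(k+1)`, with a nonzero scalar.
    rw [derivMatrix_smul, hd, map_add, evalMatrix_smul, evalMatrix_smul, evalMatrix_smul] at h2
    simp only [map_mul, map_pow, hl, hb, Nat.add_sub_cancel] at h2
    rw [Submodule.add_mem_iff_right _ (Submodule.smul_mem _ _
      (pow_mul_pow_mem_lowSpan _ k.lt_succ_self)), smul_smul] at h2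
    refine (Submodule.smul_mem_iff _ (mul_ne_zero hft ?_)).1 h2
    simpa using hp
  · filter_upwards [h] with t ht hmem
    refine absurd ?_ ht
    rw [map_mul, map_pow, map_pow, hl, hb]
    refine Submodule.span_mono ?_ hmem
    rintro _ ⟨a, i, hi, rfl⟩
    exact ⟨_, ⟨a, i, hi, rfl⟩, by rw [map_mul, map_pow, map_pow, hl, hb]⟩

/-! ### Jordan block multiplicities and Cayley–Hamilton on `im l^a` -/

section Endomorphism

variable {K V : Type*} [Field K] [AddCommGroup V] [Module K V]

open Module

/-- A nilpotent endomorphism preserving subspaces `N ≤ P` with `dim P ≤ dim N + 1` maps `P` into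
`N`. -/
theorem map_mem_of_isNilpotent_of_finrank_le [FiniteDimensional K V] {Z : End K V}
    (hZ : IsNilpotent Z) {N P : Submodule K V} (hNP : N ≤ P) (hN : ∀ x ∈ N, Z x ∈ N)
    (hP : ∀ x ∈ P, Z x ∈ P) (hd : finrank K P ≤ finrank K N + 1) {x : V} (hx : x ∈ P) :
    Z x ∈ N := by
  by_contra hZx
  have hlt : N < N ⊔ Submodule.span K {Z x} := by
    refine lt_of_le_of_ne le_sup_left fun h => hZx ?_
    rw [h]
    exact Submodule.mem_sup_right (Submodule.mem_span_singleton_self _)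
  have hle : N ⊔ Submodule.span K {Z x} ≤ P :=
    sup_le hNP ((Submodule.span_singleton_le_iff_mem _ _).2 (hP x hx))
  have heq : N ⊔ Submodule.span K {Z x} = P :=
    Submodule.eq_of_le_of_finrank_le hle (hd.trans (Submodule.finrank_lt_finrank_of_lt hlt))
  rw [← heq] at hx
  obtain ⟨y, hy, z, hz, hyz⟩ := Submodule.mem_sup.1 hx
  obtain ⟨c, rfl⟩ := Submodule.mem_span_singleton.1 hz
  -- Iterating `x = y + c • Z x` with `y ∈ N` gives `x ≡ c^m Z^m x` modulo `N`; nilpotence of `Z`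
  -- then forces `x ∈ N`.
  have hxN : ∀ m, x - c ^ m • (Z ^ m) x ∈ N := by
    intro m
    induction m with
    | zero => simp
    | succ m ih =>
      have hit : (Z ^ m) y ∈ N := by
        clear ih
        induction m with
        | zero => simpa
        | succ m ih => rw [pow_succ', Module.End.mul_apply]; exact hN _ ih
      have : x - c ^ (m + 1) • (Z ^ (m + 1)) x = (x - c ^ m • (Z ^ m) x) + c ^ m • (Z ^ m) y := by
        have : (Z ^ m) y = (Z ^ m) x - c • (Z ^ (m + 1)) x := by
          rw [eq_sub_of_add_eq hyz, map_sub, map_smul, pow_succ, Module.End.mul_apply]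
        rw [this, smul_sub, smul_smul, ← pow_succ]
        abel
      rw [this]
      exact add_mem ih (N.smul_mem _ hit)
  obtain ⟨m, hm⟩ := hZ
  have := hxN m
  rw [hm] at this
  exact hZx (hN x (by simpa using this))

/-- The subspace `ker l ∩ im (l ^ p)`. -/
def kerInfRange (l : End K V) (p : ℕ) : Submodule K V :=
  LinearMap.ker l ⊓ LinearMap.range (l ^ p)

/-- Rank–nullity for `l` restricted to `im l^p`. -/
theorem finrank_kerInfRange [FiniteDimensional K V] (l : End K V) (p : ℕ) :
    finrank K (kerInfRange l p) + finrank K (LinearMap.range (l ^ (p + 1))) =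
      finrank K (LinearMap.range (l ^ p)) := by
  have h := LinearMap.finrank_range_add_finrank_ker (l.domRestrict (LinearMap.range (l ^ p)))
  rw [LinearMap.range_domRestrict, LinearMap.ker_domRestrict, ← LinearMap.range_comp,
    ← Module.End.mul_eq_comp, ← pow_succ', add_comm] at h
  rw [← h, kerInfRange, ← Submodule.finrank_map_subtype_eq (LinearMap.range (l ^ p))
    (Submodule.comap _ (LinearMap.ker l)), Submodule.map_comap_subtype, inf_comm]

theorem kerInfRange_map_mem {l Z : End K V} (h : Commute Z l) (p : ℕ) {x : V}
    (hx : x ∈ kerInfRange l p) : Z x ∈ kerInfRange l p := by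
  obtain ⟨h1, y, rfl⟩ := hx
  refine ⟨?_, Z y, ?_⟩
  · change l (Z _) = 0
    rw [← Module.End.mul_apply, ← h.eq, Module.End.mul_apply, LinearMap.mem_ker.1 h1, map_zero]
  · rw [← Module.End.mul_apply, ← Module.End.mul_apply, (h.pow_right p).eq]

/-- If the multiplicities of the Jordan blocks of a nilpotent `l` are at most one, then in the
centralizer of `l` nilpotent elements generate nil left ideals. -/
theorem isNilpotent_mul_of_finrank_kerInfRange_le [FiniteDimensional K V] {l X Z : End K V}
    {m : ℕ} (hl : l ^ m = 0)
    (hd : ∀ p < m, finrank K (kerInfRange l p) ≤ finrank K (kerInfRange l (p + 1)) + 1)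
    (hX : Commute X l) (hZ : Commute Z l) (hnil : IsNilpotent Z) : IsNilpotent (X * Z) := by
  have hT : Commute (X * Z) l := hX.mul_left hZ
  -- `Z` drops one level because consecutive dimensions differ by at most one; `X` preserves each
  -- level.
  have hstep : ∀ p < m, ∀ x ∈ kerInfRange l p, (X * Z) x ∈ kerInfRange l (p + 1) := by
    intro p hp x hx
    refine kerInfRange_map_mem hX _ (map_mem_of_isNilpotent_of_finrank_le hnil ?_
      (fun x hx => kerInfRange_map_mem hZ _ hx) (fun x hx => kerInfRange_map_mem hZ _ hx)
      (hd p hp) hx)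
    refine inf_le_inf_left _ ?_
    rw [pow_succ]
    exact LinearMap.range_comp_le_range _ _
  have hker : ∀ p ≤ m, ∀ x ∈ LinearMap.ker l, ((X * Z) ^ p) x ∈ kerInfRange l p := by
    intro p hp x hx
    induction p with
    | zero => exact ⟨hx, x, rfl⟩
    | succ p ih =>
      rw [pow_succ', Module.End.mul_apply]
      exact hstep p (by omega) _ (ih (by omega))
  have hker0 : ∀ x ∈ LinearMap.ker l, ((X * Z) ^ m) x = 0 := by
    intro x hx
    obtain ⟨y, hy⟩ := (hker m le_rfl x hx).2
    rw [← hy, hl, LinearMap.zero_apply]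
  -- `(X * Z)^m` kills `ker l` and commutes with `l`, so it maps `ker l^(i+1)` into `ker l^i`.
  have hfil : ∀ i, ∀ x, (l ^ i) x = 0 → (((X * Z) ^ m) ^ i) x = 0 := by
    intro i
    induction i with
    | zero => simp
    | succ i ih =>
      intro x hx
      rw [pow_succ, Module.End.mul_apply]
      apply ih
      rw [← Module.End.mul_apply, ((hT.pow_left m).pow_right i).symm.eq, Module.End.mul_apply]
      apply hker0
      rwa [LinearMap.mem_ker, ← Module.End.mul_apply, ← pow_succ']
  refine ⟨m * m, ?_⟩
  ext x
  rw [pow_mul, LinearMap.zero_apply]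
  exact hfil m x (by rw [hl, LinearMap.zero_apply])

/-- The image of `l ^ a` is generated, modulo a nilpotent `l`, by `dim (ker l ∩ im l ^ a)`
elements. -/
theorem exists_finset_generators [FiniteDimensional K V] {l : End K V} (hl : IsNilpotent l)
    (a : ℕ) : ∃ s : Set V, s.Finite ∧ s.ncard ≤ finrank K (kerInfRange l a) ∧
      s ⊆ LinearMap.range (l ^ a) ∧
      ∀ N : Submodule K V, s ⊆ N → (∀ x ∈ N, l x ∈ N) → LinearMap.range (l ^ a) ≤ N := by
  set W := LinearMap.range (l ^ a)
  have hlW : W.map l ≤ W := by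
    rintro _ ⟨_, ⟨y, rfl⟩, rfl⟩
    exact ⟨l y, by rw [← Module.End.mul_apply, ← Module.End.mul_apply, ← pow_succ, ← pow_succ']⟩
  have hmap : W.map l = LinearMap.range (l ^ (a + 1)) := by
    rw [← LinearMap.range_comp, ← Module.End.mul_eq_comp, ← pow_succ']
  obtain ⟨U, hU⟩ := ((W.map l).submoduleOf W).exists_isCompl
  have hsup : W.map l ⊔ U.map W.subtype = W := by
    have := congrArg (Submodule.map W.subtype) hU.sup_eq_top
    rwa [Submodule.map_sup, Submodule.submoduleOf, Submodule.map_comap_subtype,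
      inf_eq_right.2 hlW, Submodule.map_subtype_top] at this
  have hfin : finrank K U = finrank K (kerInfRange l a) := by
    have h1 := Submodule.finrank_add_eq_of_isCompl hU
    have h2 : _ = finrank K W := finrank_kerInfRange l a
    rw [← hmap] at h2
    have h3 : finrank K ((W.map l).submoduleOf W) = finrank K (W.map l) :=
      LinearEquiv.finrank_eq (Submodule.submoduleOfEquivOfLe hlW)
    omega
  let b := Module.finBasis K U
  let f : Fin (finrank K U) → V := fun i => ((b i : W) : V)
  refine ⟨Set.range f, Set.finite_range f, ?_, ?_, ?_⟩
  · rw [← hfin, ← Set.image_univ]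
    refine (Set.ncard_image_le Set.finite_univ).trans ?_
    simp
  · rintro _ ⟨i, rfl⟩
    exact (b i : W).2
  · intro N hs hN
    have hUN : U.map W.subtype ≤ N := by
      rintro _ ⟨u, hu, rfl⟩
      have hu' : u = ∑ i, b.repr ⟨u, hu⟩ i • (b i : W) := by
        have := congrArg (fun z : U => (z : W)) (b.sum_repr ⟨u, hu⟩)
        simp only [Submodule.coe_sum, Submodule.coe_smul] at this
        exact this.symm
      rw [hu']
      simp only [Submodule.subtype_apply, Submodule.coe_sum, Submodule.coe_smul]
      exact sum_mem fun i _ => N.smul_mem _ (hs ⟨i, rfl⟩)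
    -- Nakayama's argument: iterate `W = l W + U` with `U ⊆ N` until the power of `l` vanishes.
    have hi : ∀ i, W ≤ N ⊔ W.map (l ^ i) := by
      intro i
      induction i with
      | zero => exact le_sup_of_le_right (by simp [Module.End.one_eq_id])
      | succ i ih =>
        refine ih.trans (sup_le le_sup_left ?_)
        have hNi : N.map (l ^ i) ≤ N := by
          rintro _ ⟨x, hx, rfl⟩
          clear ih
          induction i with
          | zero => simpa
          | succ i ih => rw [pow_succ', Module.End.mul_apply]; exact hN _ ih
        conv_lhs => rw [← hsup, Submodule.map_sup]
        refine sup_le ?_ ((Submodule.map_mono hUN).trans (hNi.trans le_sup_left))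
        rw [← Submodule.map_comp, ← Module.End.mul_eq_comp, ← pow_succ]
        exact le_sup_right
    obtain ⟨m, hm⟩ := hl
    simpa [hm] using hi m

open Polynomial in
/-- Cayley–Hamilton for the action of `b` on the image of `l ^ a`, as a module over `K[l]`. -/
theorem exists_pow_mul_pow_mem_lowSpan [FiniteDimensional K V] {l b : End K V}
    (hl : IsNilpotent l) (hlb : Commute l b) (a : ℕ) :
    ∃ k ≤ finrank K (kerInfRange l a), l ^ a * b ^ k ∈ lowSpan K l b k := by
  obtain ⟨s, hsf, hsc, hsW, hs⟩ := exists_finset_generators hl a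
  let _ : Module K[X] V := Module.compHom V (aeval l : K[X] →ₐ[K] End K V).toRingHom
  have hsmul (p : K[X]) (v : V) : p • v = aeval l p v := rfl
  have hcl (c : End K V) (hc : Commute l c) (p : K[X]) : Commute (aeval l p) c := by
    induction p using Polynomial.induction_on' with
    | add p q hp hq => rw [map_add]; exact hp.add_left hq
    | monomial i r =>
      rw [aeval_monomial]
      exact (Algebra.commute_algebraMap_left r c).mul_left (hc.pow_left i)
  let W : Submodule K[X] V :=
    { LinearMap.range (l ^ a) with
      smul_mem' := by
        rintro p _ ⟨y, rfl⟩
        refine ⟨p • y, ?_⟩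
        rw [hsmul, hsmul, ← Module.End.mul_apply, ← Module.End.mul_apply,
          (hcl _ ((Commute.refl l).pow_right a) p).eq] }
  let b' : V →ₗ[K[X]] V :=
    { toFun := b
      map_add' := map_add b
      map_smul' := fun p v => by
        rw [hsmul, RingHom.id_apply, hsmul, ← Module.End.mul_apply, ← Module.End.mul_apply,
          (hcl b hlb p).eq] }
  have hbW : ∀ x ∈ W, b' x ∈ W := by
    rintro _ ⟨y, rfl⟩
    refine ⟨b y, ?_⟩
    change _ = b _
    rw [← Module.End.mul_apply, ← Module.End.mul_apply, (hlb.pow_left a).eq]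
  have hspan : Submodule.span K[X] s = W := by
    refine le_antisymm (Submodule.span_le.2 hsW) fun x hx => ?_
    let N : Submodule K V :=
      { Submodule.span K[X] s with
        smul_mem' := fun c x hx => by
          have := (Submodule.span K[X] s).smul_mem (C c) hx
          rw [hsmul, aeval_C, Module.algebraMap_end_apply] at this
          exact this }
    refine hs N Submodule.subset_span (fun y hy => ?_) hx
    have := (Submodule.span K[X] s).smul_mem X hy
    rwa [hsmul, aeval_X] at this
  have hWfg : W.FG := by rw [← hspan]; exact Submodule.fg_span hsf
  have : Module.Finite K[X] W := Module.Finite.iff_fg.2 hWfg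
  -- The polynomial has degree the minimal number of generators of `im l^a` over `K[X]`, with `X`
  -- acting as `l`. Being monic, it lets `l^a b^k` be solved for.
  obtain ⟨p, hpm, hpd, hp0⟩ :=
    LinearMap.exists_monic_and_natDegree_eq_and_aeval_eq_zero K[X] (b'.restrict hbW)
  have hdeg : p.natDegree ≤ finrank K (kerInfRange l a) := by
    rw [hpd]
    refine le_trans ?_ hsc
    rw [Submodule.spanFinrank_top, ← hspan]
    exact Submodule.spanFinrank_span_le_ncard_of_finite hsf
  refine ⟨p.natDegree, hdeg, ?_⟩
  have hrel : ∑ i ∈ Finset.range (p.natDegree + 1),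
      aeval l (p.coeff i) * (l ^ a * b ^ i) = 0 := by
    ext x
    let w : W := ⟨(l ^ a) x, x, rfl⟩
    have hw (i : ℕ) : ((((b'.restrict hbW) ^ i) w : W) : V) = (l ^ a * b ^ i) x := by
      rw [((hlb.pow_left a).pow_right i).eq]
      induction i with
      | zero => rfl
      | succ i ih =>
        rw [pow_succ', Module.End.mul_apply, LinearMap.coe_restrict_apply, ih, pow_succ', mul_assoc]
        rfl
    have h := congrArg (fun g : End K[X] W => ((g w : W) : V)) hp0
    rw [aeval_eq_sum_range] at h
    simp only [LinearMap.sum_apply, LinearMap.smul_apply, Submodule.coe_sum, Submodule.coe_smul,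
      hw, hsmul, LinearMap.zero_apply, Submodule.coe_zero] at h
    simpa [LinearMap.sum_apply] using h
  rw [Finset.sum_range_succ, hpm.coeff_natDegree, map_one, one_mul] at hrel
  rw [eq_neg_of_add_eq_zero_right hrel]
  refine neg_mem (sum_mem fun i hi => ?_)
  have hi := Finset.mem_range.1 hi
  rw [aeval_eq_sum_range, Finset.sum_mul]
  refine sum_mem fun c _ => ?_
  rw [smul_mul_assoc, ← mul_assoc, ← pow_add]
  exact Submodule.smul_mem _ _ (pow_mul_pow_mem_lowSpan _ hi)

end Endomorphism

/-! ### Counting monomials against Jordan blocks -/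

section Multiplicity

open Module

variable {K V : Type*} [Field K] [AddCommGroup V] [Module K V] [FiniteDimensional K V]

/-- The ranks of the powers of `l` telescope. -/
theorem sum_finrank_kerInfRange {l : End K V} {m : ℕ} (hl : l ^ m = 0) :
    ∑ a ∈ Finset.range m, finrank K (kerInfRange l a) = finrank K V := by
  have h : ∀ i, ∑ a ∈ Finset.range i, finrank K (kerInfRange l a) +
      finrank K (LinearMap.range (l ^ i)) = finrank K V := by
    intro i
    induction i with
    | zero =>
      rw [Finset.sum_range_zero, zero_add, pow_zero, Module.End.one_eq_id, LinearMap.range_id,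
        finrank_top]
    | succ i ih => rw [Finset.sum_range_succ, ← ih, add_assoc, finrank_kerInfRange]
  rw [← h m, hl, LinearMap.range_zero, finrank_bot, add_zero]

/-- If `l` and `b` generate an algebra of dimension `dim V` and relations for `b` over `K[l]` can be
differentiated, then all Jordan blocks of `l` have multiplicity at most one. -/
theorem finrank_kerInfRange_le_succ {l b : End K V} {m : ℕ} (hl : l ^ m = 0) (hlb : Commute l b)
    (hdim : finrank K V ≤ finrank K (Algebra.adjoin K {l, b}))
    (hder : ∀ p k, l ^ (p + 1) * b ^ k ∈ lowSpan K l b k →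
      l ^ p * b ^ (k + 1) ∈ lowSpan K l b (k + 1)) {p : ℕ} (hp : p < m) :
    finrank K (kerInfRange l p) ≤ finrank K (kerInfRange l (p + 1)) + 1 := by
  classical
  have hex (a : ℕ) := exists_pow_mul_pow_mem_lowSpan ⟨m, hl⟩ hlb a
  have hex' (a : ℕ) : ∃ k, l ^ a * b ^ k ∈ lowSpan K l b k := (hex a).imp fun _ h => h.2
  let N (a : ℕ) : ℕ := Nat.find (hex' a)
  have hN (a : ℕ) : l ^ a * b ^ N a ∈ lowSpan K l b (N a) := Nat.find_spec (hex' a)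
  have hNle (a : ℕ) : N a ≤ finrank K (kerInfRange l a) := by
    obtain ⟨k, hk, hk'⟩ := hex a
    exact (Nat.find_min' _ hk').trans hk
  -- The range `m + 1`, not `m`, keeps the index `p + 1` in the sums even when `p = m - 1`.
  let S : Finset (Σ _ : ℕ, ℕ) := (Finset.range (m + 1)).sigma fun a => Finset.range (N a)
  let W : Submodule K (End K V) :=
    Submodule.span K (S.image fun x => l ^ x.1 * b ^ x.2 : Finset (End K V))
  have hWcard : finrank K W ≤ ∑ a ∈ Finset.range (m + 1), N a := by
    refine (finrank_span_finset_le_card _).trans (Finset.card_image_le.trans ?_)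
    simp [S, Finset.card_sigma]
  have hW : ∀ k a, l ^ a * b ^ k ∈ W := by
    intro k
    induction k using Nat.strong_induction_on with
    | _ k ih =>
      intro a
      have hlow : lowSpan K l b k ≤ W := by
        refine Submodule.span_le.2 ?_
        rintro _ ⟨c, i, hi, rfl⟩
        exact ih i hi c
      rcases lt_or_ge k (N a) with hk | hk
      · rcases lt_or_ge a (m + 1) with ha | ha
        · refine Submodule.subset_span ?_
          simp only [Finset.coe_image]
          exact ⟨⟨a, k⟩, by simp [S, ha, hk], rfl⟩
        · rw [pow_eq_zero_of_le (by omega) hl, zero_mul]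
          exact W.zero_mem
      · apply hlow
        obtain ⟨d, rfl⟩ := Nat.exists_eq_add_of_le hk
        have hmul : ∀ x ∈ lowSpan K l b (N a), x * b ^ d ∈ lowSpan K l b (N a + d) := by
          intro x hx
          induction hx using Submodule.span_induction with
          | mem x h =>
            obtain ⟨c, i, hi, rfl⟩ := h
            rw [mul_assoc, ← pow_add]
            exact pow_mul_pow_mem_lowSpan _ (by omega)
          | zero => simp
          | add x y _ _ hx hy => rw [add_mul]; exact add_mem hx hy
          | smul c x _ hx => rw [smul_mul_assoc]; exact Submodule.smul_mem _ _ hx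
        rw [pow_add, ← mul_assoc]
        exact hmul _ (hN a)
  have hgen : ∀ y ∈ ({l, b} : Set (End K V)), ∀ w ∈ W, y * w ∈ W := by
    intro y hy w hw
    induction hw using Submodule.span_induction with
    | mem x h =>
      obtain ⟨⟨a, k⟩, _, rfl⟩ := by simpa only [Finset.coe_image] using h
      rcases hy with rfl | rfl
      · rw [← mul_assoc, ← pow_succ']
        exact hW _ _
      · rw [← mul_assoc, ← (hlb.pow_left a).eq, mul_assoc, ← pow_succ']
        exact hW _ _
    | zero => simp
    | add x z _ _ hx hz => rw [mul_add]; exact add_mem hx hz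
    | smul c x _ hx => rw [mul_smul_comm]; exact W.smul_mem _ hx
  have hadj : ∀ y ∈ Algebra.adjoin K {l, b}, ∀ w ∈ W, y * w ∈ W := by
    intro y hy
    induction hy using Algebra.adjoin_induction with
    | mem y hy => exact hgen y hy
    | algebraMap r =>
      intro w hw
      rw [← Algebra.smul_def]
      exact W.smul_mem _ hw
    | add x z _ _ hx hz => intro w hw; rw [add_mul]; exact add_mem (hx w hw) (hz w hw)
    | mul x z _ _ hx hz => intro w hw; rw [mul_assoc]; exact hx _ (hz w hw)
  have hle : Subalgebra.toSubmodule (Algebra.adjoin K {l, b}) ≤ W := by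
    intro y hy
    have h1 : (1 : End K V) ∈ W := by simpa using hW 0 0
    simpa using hadj y hy 1 h1
  have hsum : ∑ a ∈ Finset.range (m + 1), finrank K (kerInfRange l a) ≤
      ∑ a ∈ Finset.range (m + 1), N a := by
    rw [sum_finrank_kerInfRange (pow_eq_zero_of_le m.le_succ hl)]
    exact hdim.trans ((Submodule.finrank_mono hle).trans hWcard)
  -- Termwise inequalities whose sums agree are equalities, so the claim becomes `N p ≤ N (p + 1) +
  -- 1`.
  have heq := (Finset.sum_eq_sum_iff_of_le fun a _ => hNle a).1
    (le_antisymm (Finset.sum_le_sum fun a _ => hNle a) hsum)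
  rw [← heq p (by simp; omega), ← heq (p + 1) (by simp; omega)]
  exact Nat.find_min' _ (hder _ _ (hN (p + 1)))

end Multiplicity

/-! ### The Jacobson radical, the socle degree, and the transfer to matrices -/

/-- An element of a ring all of whose left multiples are nilpotent lies in the Jacobson radical. -/
theorem mem_ringJacobson_of_isNilpotent_mul {R : Type*} [Ring R] {x : R}
    (h : ∀ y, IsNilpotent (y * x)) : x ∈ Ring.jacobson R := by
  rw [← Ideal.jacobson_bot, Ideal.mem_jacobson_iff]
  intro y
  obtain ⟨u, hu⟩ := (h y).isUnit_one_add
  refine ⟨(↑u⁻¹ : R), ?_⟩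
  have : (↑u⁻¹ : R) * y * x + ↑u⁻¹ - 1 = ↑u⁻¹ * (1 + y * x) - 1 := by noncomm_ring
  rw [this, ← hu, Units.inv_mul, sub_self]
  exact Submodule.zero_mem _

/-- Powers of a nilpotent ideal beyond the socle degree vanish. -/
theorem IsSocleDegree.pow_succ_eq_bot {K R : Type*} [Field K] [CommRing R] [Algebra K R]
    [FiniteDimensional K R] {I : Ideal R} (hI : IsNilpotent I) {j : ℕ}
    (hj : IsSocleDegree K I j) : I ^ (j + 1) = ⊥ := by
  have hstep : ∀ i, j < i → I ^ i ≤ I ^ (i + 1) := by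
    intro i hi
    have h0 : hilbertFunction K I i = 0 := by
      by_contra h
      exact absurd (hj.2 h) (not_le.2 hi)
    have hsub : Subsingleton (gradedPiece K I i) := Module.finrank_zero_iff.1 h0
    rw [Submodule.Quotient.subsingleton_iff] at hsub
    intro x hx
    have : (⟨x, hx⟩ : ↥((I ^ i).restrictScalars K)) ∈
        ((I ^ (i + 1)).restrictScalars K).submoduleOf ((I ^ i).restrictScalars K) := by
      rw [hsub]; trivial
    exact this
  have hall : ∀ i, I ^ (j + 1) ≤ I ^ (j + 1 + i) := by
    intro i
    induction i with
    | zero => exact le_rfl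
    | succ i ih => exact ih.trans (hstep _ (by omega))
  obtain ⟨m, hm⟩ := hI
  rw [eq_bot_iff]
  refine (hall m).trans ((Ideal.pow_le_pow_right (Nat.le_add_left m (j + 1))).trans ?_)
  rw [hm]
  exact le_rfl

section Pair

variable {K : Type*} [Field K] {n : ℕ} {A B : Matrix (Fin n) (Fin n) K}

/-- The product lies in `M^(p+k) ⊆ M^(j+1) = 0`. -/
theorem IsPairSocleDegree.pow_mul_pow_eq_zero (hA : IsNilpotent A) (hB : IsNilpotent B)
    (hAB : Commute A B) {j : ℕ} (hj : IsPairSocleDegree hAB j) (t : K) {p k : ℕ}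
    (hpk : j < p + k) : (A + t • B) ^ p * B ^ k = 0 := by
  let _ : CommRing (pairAlgebra A B) := pairCommRing hAB
  let a : pairAlgebra A B := ⟨A, Algebra.subset_adjoin (Set.mem_insert A {B})⟩
  let b : pairAlgebra A B := ⟨B, Algebra.subset_adjoin (Set.mem_insert_of_mem A rfl)⟩
  let I : Ideal (pairAlgebra A B) := Ideal.span {a, b}
  have ha : IsNilpotent a := by
    obtain ⟨m, hm⟩ := hA
    exact ⟨m, Subtype.ext hm⟩
  have hb : IsNilpotent b := by
    obtain ⟨m, hm⟩ := hB
    exact ⟨m, Subtype.ext hm⟩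
  have hI : IsNilpotent I := by
    have hfg : I.FG := Submodule.fg_span ((Set.finite_singleton b).insert a)
    refine (Ideal.FG.isNilpotent_iff_le_nilradical hfg).2 (Ideal.span_le.2 ?_)
    rintro _ (rfl | rfl)
    exacts [ha, hb]
  have hbot : I ^ (j + 1) = ⊥ := IsSocleDegree.pow_succ_eq_bot hI hj
  have haI : a ∈ I := Ideal.subset_span (Set.mem_insert _ _)
  have hbI : b ∈ I := Ideal.subset_span (Set.mem_insert_of_mem _ rfl)
  have htb : algebraMap K (pairAlgebra A B) t * b ∈ I := I.mul_mem_left _ hbI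
  have hmem : (a + algebraMap K (pairAlgebra A B) t * b) ^ p * b ^ k ∈ I ^ (j + 1) := by
    refine Ideal.pow_le_pow_right (Nat.succ_le_of_lt hpk) ?_
    rw [pow_add]
    exact Ideal.mul_mem_mul (Ideal.pow_mem_pow (I.add_mem haI htb) p) (Ideal.pow_mem_pow hbI k)
  rw [hbot] at hmem
  have h0 := congrArg (Subtype.val : pairAlgebra A B → _) ((Submodule.mem_bot _).1 hmem)
  rw [Algebra.smul_def]
  exact h0

theorem pairAlgebra_le_adjoin_add_smul (A B : Matrix (Fin n) (Fin n) K) (t : K) :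
    pairAlgebra A B ≤ Algebra.adjoin K {A + t • B, B} := by
  have hB : B ∈ Algebra.adjoin K {A + t • B, B} :=
    Algebra.subset_adjoin (Set.mem_insert_of_mem _ rfl)
  refine Algebra.adjoin_le ?_
  rw [Set.insert_subset_iff, Set.singleton_subset_iff]
  refine ⟨?_, hB⟩
  have h : A + t • B ∈ Algebra.adjoin K {A + t • B, B} :=
    Algebra.subset_adjoin (Set.mem_insert _ _)
  simpa using sub_mem h (Subalgebra.smul_mem _ hB t)

/-- If `K[A, B]` has dimension `n` and relations for `b` over `K[l]` can be differentiated, then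
nilpotent matrices commuting with `l` lie in the radical of the centralizer of `l`. -/
theorem memCentralizerRadical_of_lowSpan_derivative {l b Z : Matrix (Fin n) (Fin n) K}
    (hl : IsNilpotent l) (hlb : Commute l b)
    (hdim : n ≤ Module.finrank K (Algebra.adjoin K {l, b}))
    (hder : ∀ p k, l ^ (p + 1) * b ^ k ∈ lowSpan K l b k →
      l ^ p * b ^ (k + 1) ∈ lowSpan K l b (k + 1))
    (hZ : Commute Z l) (hnil : IsNilpotent Z) : MemCentralizerRadical l Z := by
  let φ : Matrix (Fin n) (Fin n) K ≃ₐ[K] Module.End K (Fin n → K) := Matrix.toLinAlgEquiv'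
  have hmem (k : ℕ) (x : Matrix (Fin n) (Fin n) K) :
      φ x ∈ lowSpan K (φ l) (φ b) k ↔ x ∈ lowSpan K l b k := by
    have : lowSpan K (φ l) (φ b) k = (lowSpan K l b k).map φ.toLinearMap := by
      rw [lowSpan, lowSpan, Submodule.map_span]
      congr 1
      ext y
      constructor
      · rintro ⟨a, i, hi, rfl⟩
        exact ⟨_, ⟨a, i, hi, rfl⟩, by simp⟩
      · rintro ⟨_, ⟨a, i, hi, rfl⟩, rfl⟩
        exact ⟨a, i, hi, by simp⟩
    rw [this]
    exact Function.Injective.mem_set_image φ.injective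
  obtain ⟨m, hm⟩ := hl
  have hφm : φ l ^ m = 0 := by rw [← map_pow, hm, map_zero]
  have hadj : Algebra.adjoin K {φ l, φ b} = (Algebra.adjoin K {l, b}).map φ.toAlgHom := by
    rw [AlgHom.map_adjoin, Set.image_pair]
    rfl
  have hd : Module.finrank K (Fin n → K) ≤ Module.finrank K (Algebra.adjoin K {φ l, φ b}) := by
    rw [hadj, Module.finrank_fin_fun, ← LinearEquiv.finrank_eq
      ((Algebra.adjoin K {l, b}).equivMapOfInjective φ.toAlgHom φ.injective).toLinearEquiv]
    exact hdim
  have hmult (p : ℕ) (hp : p < m) := finrank_kerInfRange_le_succ hφm (hlb.map φ) hd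
    (fun p k h => by
      rw [← map_pow, ← map_pow, ← map_mul, hmem] at h ⊢
      exact hder p k h) hp
  have hZmem : Z ∈ matrixCentralizer l := by
    rw [Subalgebra.mem_centralizer_iff]
    rintro _ rfl
    exact hZ.symm.eq
  refine ⟨hZmem, mem_ringJacobson_of_isNilpotent_mul fun X => ?_⟩
  have hX : Commute (X : Matrix (Fin n) (Fin n) K) l :=
    (Subalgebra.mem_centralizer_iff K |>.1 X.2 l rfl).symm
  obtain ⟨r, hr⟩ := isNilpotent_mul_of_finrank_kerInfRange_le hφm hmult (hX.map φ) (hZ.map φ)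
    (hnil.map φ)
  refine ⟨r, Subtype.ext (φ.injective ?_)⟩
  rw [← map_mul, ← map_pow] at hr
  exact hr.trans (map_zero φ).symm

end Pair

theorem mainTheorem8 {K : Type*} [Field K] [IsAlgClosed K] {n : ℕ}
    (A B : Matrix (Fin n) (Fin n) K)
    (hA : IsNilpotent A) (hB : IsNilpotent B) (hAB : Commute A B)
    (hdim : Module.finrank K (pairAlgebra A B) = n)
    (j : ℕ) (hj : IsPairSocleDegree hAB j)
    (hchar : ringChar K = 0 ∨ j < ringChar K) :
    ∀ᶠ t : K in Filter.cofinite,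
      MemCentralizerRadical (A + t • B) A ∧ MemCentralizerRadical (A + t • B) B := by
  have hne (p : ℕ) (hp : p + 1 ≤ j) : ((p + 1 : ℕ) : K) ≠ 0 := by
    intro h
    have hdvd := (ringChar.spec K (p + 1)).1 h
    rcases hchar with h0 | hlt
    · rw [h0, zero_dvd_iff] at hdvd
      omega
    · exact absurd (Nat.le_of_dvd p.succ_pos hdvd) (by omega)
  -- Only finitely many pairs `(p, k)` are needed, so the exceptional `t` stay finite in number.
  have hev : ∀ᶠ t : K in Filter.cofinite, ∀ p ∈ Finset.range j, ∀ k ∈ Finset.range (j + 1),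
      (A + t • B) ^ (p + 1) * B ^ k ∈ lowSpan K (A + t • B) B k →
        (A + t • B) ^ p * B ^ (k + 1) ∈ lowSpan K (A + t • B) B (k + 1) := by
    rw [Filter.eventually_all_finset]
    intro p hp
    rw [Filter.eventually_all_finset]
    intro k _
    exact eventually_lowSpan_derivative hAB p k (hne p (Finset.mem_range.1 hp))
  filter_upwards [hev] with t ht
  have hder : ∀ p k, (A + t • B) ^ (p + 1) * B ^ k ∈ lowSpan K (A + t • B) B k →
      (A + t • B) ^ p * B ^ (k + 1) ∈ lowSpan K (A + t • B) B (k + 1) := by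
    intro p k h
    -- Beyond the socle degree the target product is zero; otherwise `p + 1 ≤ j`, where `p + 1` is
    -- invertible in `K`.
    rcases lt_or_ge j (p + (k + 1)) with hlt | hle
    · rw [hj.pow_mul_pow_eq_zero hA hB hAB t hlt]
      exact Submodule.zero_mem _
    · exact ht p (Finset.mem_range.2 (by omega)) k (Finset.mem_range.2 (by omega)) h
  have hl : IsNilpotent (A + t • B) :=
    ⟨j + 1, by simpa using hj.pow_mul_pow_eq_zero hA hB hAB t (p := j + 1) (k := 0) (by omega)⟩
  have hBl : Commute B (A + t • B) := hAB.symm.add_right ((Commute.refl B).smul_right t)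
  have hAl : Commute A (A + t • B) := (Commute.refl A).add_right (hAB.smul_right t)
  have hd : n ≤ Module.finrank K (Algebra.adjoin K {A + t • B, B}) :=
    hdim.symm.le.trans <| Submodule.finrank_mono (s := Subalgebra.toSubmodule (pairAlgebra A B))
      (t := Subalgebra.toSubmodule (Algebra.adjoin K {A + t • B, B}))
      (pairAlgebra_le_adjoin_add_smul A B t)
  exact ⟨memCentralizerRadical_of_lowSpan_derivative hl hBl.symm hd hder hAl hA,
    memCentralizerRadical_of_lowSpan_derivative hl hBl.symm hd hder hBl hB⟩
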